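/- Let $X$ be a metric space, and let $\mathcal{O}$ denote the collection of all open covers of $X$. A family $\mathcal{T}$ of subsets of $X$ \emph{refines} $\mathcal{U}$ if every member of $\mathcal{T}$ is contained in some member of $\mathcal{U}$. In the game $\mathsf{G}_c^{\omega}(\mathcal{O},\mathcal{O})$, players ONE and TWO play one inning for each $n=0,1,2,\dots$: in the $n$-th inning ONE first chooses $\mathcal{O}_n\in\mathcal{O}$, and then TWO responds with a family $\mathcal{T}_n$ of pairwise disjoint subsets of $X$ that refines $\mathcal{O}_n$. TWO wins the play if $\bigcup_{n<\omega}\mathcal{T}_n$ is an open cover of $X$; otherwise ONE wins. Call $X$ \emph{countable dimensional} if it is the union of countably many subspaces, each of covering dimension at most $0$, where a space has covering dimension at most $0$ if each of its finite open covers is refined by a finite open cover consisting of pairwise disjoint sets. Then: \begin{enumerate} \item If $X$ is countable dimensional, then TWO has a winning strategy in $\mathsf{G}_c^{\omega}(\mathcal{O},\mathcal{O})$. \item If TWO has a winning strategy in $\mathsf{G}_c^{\omega}(\mathcal{O},\mathcal{O})$, then $X$ is countable dimensional. \end{enumerate} -/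

import Mathlib

/-- `𝒱` refines `𝒰`: every member of `𝒱` is contained in some member of `𝒰`. -/
def Refines {X : Type*} (𝒱 𝒰 : Set (Set X)) : Prop :=
  ∀ V ∈ 𝒱, ∃ U ∈ 𝒰, V ⊆ U

/-- The collection `𝒪` of all open covers of the space `X`. -/
def openCovers (X : Type*) [TopologicalSpace X] : Set (Set (Set X)) :=
  {𝒰 | (∀ U ∈ 𝒰, IsOpen U) ∧ ⋃₀ 𝒰 = Set.univ}

/-- A strategy for TWO: it gives the answer in inning `n` as a function of the moves
`O 0, …, O n` that ONE has made so far. -/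
def StrategyTwo (S : Type*) : Type _ :=
  (n : ℕ) → (Fin (n + 1) → Set (Set S)) → Set (Set S)

/-- TWO's answer in inning `n` when TWO follows `σ` and ONE plays `O 0, O 1, …`. -/
def StrategyTwo.answer {S : Type*} (σ : StrategyTwo S) (O : ℕ → Set (Set S)) (n : ℕ) :
    Set (Set S) :=
  σ n (fun i => O i)

/-- `σ` is a winning strategy for TWO in the game `G_c^ω(𝒜, ℬ)`: whenever ONE plays members
of `𝒜`, every answer of `σ` is a legal move (a pairwise disjoint family that refines the
member of `𝒜` just played), and the union of all the answers is a member of `ℬ`. -/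
def StrategyTwo.IsWinning {S : Type*} (𝒜 ℬ : Set (Set (Set S))) (σ : StrategyTwo S) : Prop :=
  ∀ O : ℕ → Set (Set S), (∀ n, O n ∈ 𝒜) →
    (∀ n, (σ.answer O n).PairwiseDisjoint id ∧ Refines (σ.answer O n) (O n)) ∧
    (⋃ n, σ.answer O n) ∈ ℬ

/-- TWO has a winning strategy in `G_c^ω(𝒜, ℬ)`. -/
def TwoHasWinningStrategy {S : Type*} (𝒜 ℬ : Set (Set (Set S))) : Prop :=
  ∃ σ : StrategyTwo S, σ.IsWinning 𝒜 ℬ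

/-- The covering dimension of `X` is at most `n`: every finite open cover has a finite open
cover refining it such that every point lies in at most `n + 1` members. -/
def CoveringDimLE (X : Type*) [TopologicalSpace X] (n : ℕ) : Prop :=
  ∀ 𝒰 ∈ openCovers X, 𝒰.Finite →
    ∃ 𝒱 ∈ openCovers X, 𝒱.Finite ∧ Refines 𝒱 𝒰 ∧
      ∀ x : X, {V ∈ 𝒱 | x ∈ V}.encard ≤ n + 1

/-- `X` is countable dimensional: it is the union of countably many subspaces of covering
dimension zero (the empty subspace is allowed). -/
def CountableDimensional (X : Type*) [TopologicalSpace X] : Prop :=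
  ∃ Y : ℕ → Set X, (∀ i, CoveringDimLE (Y i) 0) ∧ (⋃ i, Y i) = Set.univ

/-!
Both directions rest on the fact that covering dimension zero is about partitions into open sets.

If `Y` is metrizable of covering dimension zero, then disjoint closed sets in `Y` are separated by
clopen sets, and paracompactness upgrades this to arbitrary open covers: shrink a locally finite
open refinement to clopen sets, and disjointify along a well-order. Local finiteness keeps the
differences open (`exists_pairwise_disjoint_open_refinement`). A disjoint family of relatively open
subsets of `Y` extends to a disjoint family of open subsets of the ambient metric space by taking
unions of balls of half the available radius (`exists_disjoint_open_family_covering`). If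
`X = ⋃ n, Y n` with every `Y n` zero-dimensional, TWO wins by covering `Y n` in inning `n`.

Conversely, let TWO follow a winning strategy and let ONE play only the covers `ballCover X n` by
balls of radius `1 / (n + 1)`. For a finite sequence `τ` of indices, `coreSet σ τ` is the set of
points covered by TWO's next answer whatever `n` ONE plays after `τ`. There are countably many `τ`,
and a point outside all these sets would let ONE build a play in which it is never covered. Each of
these sets has, for every `n`, a partition into open sets lying in balls of radius `1 / (n + 1)`.
The common refinements of these partitions form a tree, and the minimal levels at which its cells
fit into members of a given cover yield a disjoint refinement (`coveringDimLE_zero_of_partitions`).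
-/

/-! ### Zero-dimensional metrizable spaces -/

/-- Apply the dimension hypothesis to the cover `{Aᶜ, Bᶜ}`. -/
theorem CoveringDimLE.exists_isClopen_separating {Y : Type*} [TopologicalSpace Y]
    (h : CoveringDimLE Y 0) {A B : Set Y} (hA : IsClosed A) (hB : IsClosed B)
    (hAB : Disjoint A B) : ∃ C : Set Y, IsClopen C ∧ A ⊆ C ∧ Disjoint C B := by
  obtain ⟨𝒱, ⟨hVo, hVc⟩, -, hVr, hV1⟩ := h {Aᶜ, Bᶜ} ⟨by
      rintro U (rfl | rfl)
      exacts [hA.isOpen_compl, hB.isOpen_compl], by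
      rw [Set.sUnion_pair, ← Set.compl_inter, hAB.inter_eq, Set.compl_empty]⟩ (by simp)
  have huniq : ∀ x, ∀ V ∈ 𝒱, ∀ W ∈ 𝒱, x ∈ V → x ∈ W → V = W := by
    intro x V hV W hW hxV hxW
    have h1 := hV1 x
    simp only [Nat.cast_zero, zero_add, Set.encard_le_one_iff] at h1
    exact h1 V W ⟨hV, hxV⟩ ⟨hW, hxW⟩
  have hcov : ∀ x, ∃ V ∈ 𝒱, x ∈ V := fun x => by
    rw [← Set.mem_sUnion, hVc]; trivial
  refine ⟨⋃₀ {V ∈ 𝒱 | (V ∩ A).Nonempty}, ⟨?_, ?_⟩, ?_, ?_⟩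
  · have : (⋃₀ {V ∈ 𝒱 | (V ∩ A).Nonempty})ᶜ = ⋃₀ {V ∈ 𝒱 | ¬ (V ∩ A).Nonempty} := by
      ext x
      constructor
      · intro hx
        obtain ⟨V, hV, hxV⟩ := hcov x
        exact ⟨V, ⟨hV, fun hn => hx ⟨V, ⟨hV, hn⟩, hxV⟩⟩, hxV⟩
      · rintro ⟨V, ⟨hV, hn⟩, hxV⟩ ⟨W, ⟨hW, hWn⟩, hxW⟩
        exact hn (huniq x V hV W hW hxV hxW ▸ hWn)
    rw [← isOpen_compl_iff, this]
    exact isOpen_sUnion fun V hV => hVo V hV.1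
  · exact isOpen_sUnion fun V hV => hVo V hV.1
  · intro x hx
    obtain ⟨V, hV, hxV⟩ := hcov x
    exact ⟨V, ⟨hV, x, hxV, hx⟩, hxV⟩
  · rw [Set.disjoint_left]
    rintro x ⟨V, ⟨hV, y, hyV, hyA⟩, hxV⟩ hxB
    obtain ⟨U, rfl | rfl, hVU⟩ := hVr V hV
    · exact hVU hyV hyA
    · exact hVU hxV hxB

/-- In a metrizable space of covering dimension zero, the defining property extends from finite
open covers to all open covers. -/
theorem exists_pairwise_disjoint_open_refinement {Y ι : Type*} [MetricSpace Y]
    (h : CoveringDimLE Y 0) (u : ι → Set Y) (uo : ∀ i, IsOpen (u i))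
    (uc : ⋃ i, u i = Set.univ) :
    ∃ v : ι → Set Y, (∀ i, IsOpen (v i)) ∧ (∀ i, v i ⊆ u i) ∧
      Pairwise (Function.onFun Disjoint v) ∧
      ⋃ i, v i = Set.univ := by
  obtain ⟨w, wo, wc, wlf, wu⟩ := precise_refinement u uo uc
  obtain ⟨F, Fc, Fcl, Fw⟩ := exists_iUnion_eq_closed_subset wo (fun x => wlf.point_finite x) wc
  have hsep : ∀ i, ∃ C : Set Y, IsClopen C ∧ F i ⊆ C ∧ Disjoint C (w i)ᶜ := fun i =>
    h.exists_isClopen_separating (Fcl i) (wo i).isClosed_compl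
      (Set.disjoint_compl_right_iff_subset.2 (Fw i))
  choose C hC hFC hCw using hsep
  replace hCw : ∀ i, C i ⊆ w i := fun i => Set.disjoint_compl_right_iff_subset.1 (hCw i)
  have Clf : LocallyFinite C := wlf.subset hCw
  let r : ι → ι → Prop := WellOrderingRel
  refine ⟨fun i => C i \ ⋃ j : {j // r j i}, C j, fun i => ?_,
    fun i => Set.sdiff_subset.trans ((hCw i).trans (wu i)), ?_, ?_⟩
  · exact (hC i).isOpen.sdiff ((Clf.comp_injective Subtype.val_injective).isClosed_iUnion
      fun j => (hC j).isClosed)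
  · intro i j hij
    rw [Function.onFun, Set.disjoint_left]
    rintro x ⟨hxi, hni⟩ ⟨hxj, hnj⟩
    rcases trichotomous_of r i j with hr | hr | hr
    · exact hnj (Set.mem_iUnion.2 ⟨⟨i, hr⟩, hxi⟩)
    · exact hij hr
    · exact hni (Set.mem_iUnion.2 ⟨⟨j, hr⟩, hxj⟩)
  · refine Set.eq_univ_of_forall fun x => ?_
    have hne : {i | x ∈ C i}.Nonempty := by
      obtain ⟨i, hi⟩ := Set.mem_iUnion.1 (Fc.symm ▸ Set.mem_univ x : x ∈ ⋃ i, F i)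
      exact ⟨i, hFC i hi⟩
    have wf : WellFounded r := IsWellFounded.wf
    refine Set.mem_iUnion.2 ⟨wf.min _ hne, wf.min_mem _ hne, fun hx => ?_⟩
    obtain ⟨⟨j, hj⟩, hxj⟩ := Set.mem_iUnion.1 hx
    exact wf.not_lt_min _ hxj hj

/-- A zero-dimensional subspace of a metric space is covered by a disjoint family of open sets of
the ambient space that refines a given open cover. -/
theorem exists_disjoint_open_family_covering {X : Type*} [MetricSpace X] {Y : Set X}
    (hY : CoveringDimLE Y 0) {𝒰 : Set (Set X)} (h𝒰 : 𝒰 ∈ openCovers X) :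
    ∃ 𝒯 : Set (Set X), 𝒯.PairwiseDisjoint id ∧ Refines 𝒯 𝒰 ∧ (∀ T ∈ 𝒯, IsOpen T) ∧
      Y ⊆ ⋃₀ 𝒯 := by
  obtain ⟨v, vo, vu, vd, vc⟩ := exists_pairwise_disjoint_open_refinement hY
    (fun U : 𝒰 => ((↑) : Y → X) ⁻¹' U) (fun U => (h𝒰.1 U U.2).preimage continuous_subtype_val)
    (by rw [← Set.preimage_iUnion, ← Set.sUnion_eq_iUnion, h𝒰.2, Set.preimage_univ])
  -- a radius witnessing at once that `v U` is relatively open and that `U` is open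
  have hr : ∀ (U : 𝒰) (y : Y), ∃ r > 0, y ∈ v U →
      Metric.ball y r ⊆ v U ∧ Metric.ball (y : X) r ⊆ U := by
    intro U y
    by_cases hy : y ∈ v U
    · obtain ⟨r, r0, hr⟩ := Metric.isOpen_iff.1 (vo U) y hy
      obtain ⟨s, s0, hs⟩ := Metric.isOpen_iff.1 (h𝒰.1 U U.2) (y : X) (vu U hy)
      exact ⟨min r s, lt_min r0 s0, fun _ => ⟨(Metric.ball_subset_ball (min_le_left _ _)).trans hr,
        (Metric.ball_subset_ball (min_le_right _ _)).trans hs⟩⟩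
    · exact ⟨1, one_pos, fun h => absurd h hy⟩
  choose r r0 hr using hr
  let W : 𝒰 → Set X := fun U => ⋃ y ∈ v U, Metric.ball (y : X) (r U y / 2)
  have hW : ∀ U V, U ≠ V → Disjoint (W U) (W V) := by
    intro U V hUV
    rw [Set.disjoint_left]
    intro x hxU hxV
    simp only [W, Set.mem_iUnion, Metric.mem_ball, exists_prop] at hxU hxV
    obtain ⟨y, hy, hxy⟩ := hxU
    obtain ⟨z, hz, hxz⟩ := hxV
    have hd := Set.disjoint_left.1 (vd hUV)
    have h1 : r U y ≤ dist (y : X) z := by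
      by_contra! hlt
      exact hd ((hr U y hy).1 (by rwa [Metric.mem_ball, dist_comm, Subtype.dist_eq])) hz
    have h2 : r V z ≤ dist (y : X) z := by
      by_contra! hlt
      exact hd hy ((hr V z hz).1 (by rwa [Metric.mem_ball, Subtype.dist_eq]))
    have h3 := dist_triangle_left (y : X) z x
    linarith
  refine ⟨Set.range W, ?_, ?_, ?_, ?_⟩
  · rintro _ ⟨U, rfl⟩ _ ⟨V, rfl⟩ hne
    exact hW U V fun h => hne (h ▸ rfl)
  · rintro _ ⟨U, rfl⟩
    refine ⟨U, U.2, Set.iUnion₂_subset fun y hy => ?_⟩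
    exact (Metric.ball_subset_ball (half_le_self (r0 U y).le)).trans (hr U y hy).2
  · rintro _ ⟨U, rfl⟩
    exact isOpen_biUnion fun y _ => Metric.isOpen_ball
  · intro x hx
    obtain ⟨U, hU⟩ := Set.mem_iUnion.1 (vc.symm ▸ Set.mem_univ _ : (⟨x, hx⟩ : Y) ∈ ⋃ U, v U)
    exact ⟨W U, ⟨U, rfl⟩, Set.mem_biUnion hU (Metric.mem_ball_self (half_pos (r0 U _)))⟩

/-! ### A winning strategy from countable dimensionality -/

theorem twoHasWinningStrategy_of_countableDimensional {X : Type*} [MetricSpace X]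
    (h : CountableDimensional X) : TwoHasWinningStrategy (openCovers X) (openCovers X) := by
  classical
  obtain ⟨Y, hY, hYc⟩ := h
  choose 𝒯 hd href ho hc using
    fun n (𝒰 : openCovers X) => exists_disjoint_open_family_covering (hY n) 𝒰.2
  refine ⟨fun n O => if hO : O (Fin.last n) ∈ openCovers X then 𝒯 n ⟨_, hO⟩ else ∅, fun O hO => ?_⟩
  have hans : ∀ n, StrategyTwo.answer (fun n O => if hO : O (Fin.last n) ∈ openCovers X
      then 𝒯 n ⟨_, hO⟩ else ∅) O n = 𝒯 n ⟨O n, hO n⟩ := fun n => dif_pos (hO n)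
  simp only [hans]
  refine ⟨fun n => ⟨hd n _, href n _⟩, ?_, ?_⟩
  · intro U hU
    obtain ⟨n, hn⟩ := Set.mem_iUnion.1 hU
    exact ho n _ U hn
  · refine Set.eq_univ_of_forall fun x => ?_
    obtain ⟨n, hn⟩ := Set.mem_iUnion.1 (hYc.symm ▸ Set.mem_univ x : x ∈ ⋃ n, Y n)
    obtain ⟨T, hT, hxT⟩ := hc n ⟨O n, hO n⟩ hn
    exact ⟨T, Set.mem_iUnion.2 ⟨n, hT⟩, hxT⟩

/-! ### Dimension zero from partitions into small open sets -/

/-- A space with a sequence of partitions into open sets whose cells form a basis has covering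
dimension zero. Here `D n y` is the cell of `y` in the `n`-th partition. -/
theorem coveringDimLE_zero_of_partitions {Y : Type*} [TopologicalSpace Y] (D : ℕ → Y → Set Y)
    (Dopen : ∀ n y, IsOpen (D n y)) (Dself : ∀ n y, y ∈ D n y)
    (Deq : ∀ n y, ∀ z ∈ D n y, D n z = D n y)
    (Dbasis : ∀ y U, IsOpen U → y ∈ U → ∃ n, D n y ⊆ U) : CoveringDimLE Y 0 := by
  classical
  intro 𝒰 h𝒰 hfin
  let c : ℕ → Y → Set Y := fun n y => ⋂ k ∈ Set.Iic n, D k y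
  have cself : ∀ n y, y ∈ c n y := fun n y => Set.mem_iInter₂.2 fun k _ => Dself k y
  have ceq : ∀ n y, ∀ z ∈ c n y, ∀ m ≤ n, c m z = c m y := by
    intro n y z hz m hm
    refine Set.iInter₂_congr fun k hk => Deq k y z ?_
    exact Set.mem_iInter₂.1 hz k (le_trans hk hm)
  have hex : ∀ y, ∃ n, ∃ U ∈ 𝒰, c n y ⊆ U := by
    intro y
    obtain ⟨U, hU, hyU⟩ := (h𝒰.2.symm ▸ Set.mem_univ y : y ∈ ⋃₀ 𝒰)
    obtain ⟨n, hn⟩ := Dbasis y U (h𝒰.1 U hU) hyU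
    exact ⟨n, U, hU, (Set.biInter_subset_of_mem (Set.mem_Iic.2 le_rfl)).trans hn⟩
  let N : Y → ℕ := fun y => Nat.find (hex y)
  let e : Y → Set Y := fun y => c (N y) y
  -- the least level is constant on the cell it selects, so the selected cells form a partition
  have eeq : ∀ y, ∀ z ∈ e y, e z = e y := by
    intro y z hz
    have hN : N z = N y := by
      refine (Nat.find_eq_iff (hex z)).2 ⟨?_, fun m hm => ?_⟩
      · rw [ceq _ y z hz _ le_rfl]
        exact Nat.find_spec (hex y)
      · rw [ceq _ y z hz _ hm.le]
        exact Nat.find_min (hex y) hm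
    simp only [e, hN]
    exact ceq _ y z hz _ le_rfl
  have hg : ∀ A : Set Y, ∃ U, (∃ y, A = e y) → U ∈ 𝒰 ∧ A ⊆ U := by
    intro A
    by_cases hA : ∃ y, A = e y
    · obtain ⟨y, rfl⟩ := hA
      obtain ⟨U, hU⟩ := Nat.find_spec (hex y)
      exact ⟨U, fun _ => hU⟩
    · exact ⟨∅, fun h => absurd h hA⟩
  choose g hg using hg
  -- merging the cells assigned to the same member of `𝒰` makes the refinement finite
  let V : Set Y → Set Y := fun U => {y | g (e y) = U}
  refine ⟨V '' 𝒰, ⟨?_, ?_⟩, hfin.image V, ?_, fun y => ?_⟩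
  · rintro _ ⟨U, -, rfl⟩
    refine isOpen_iff_forall_mem_open.2 fun y hy => ⟨e y, fun z hz => ?_, ?_, cself _ y⟩
    · exact (congrArg g (eeq y z hz)).trans hy
    · exact (Set.finite_Iic _).isOpen_biInter fun k _ => Dopen k y
  · exact Set.eq_univ_of_forall fun y =>
      ⟨V (g (e y)), ⟨_, (hg (e y) ⟨y, rfl⟩).1, rfl⟩, rfl⟩
  · rintro _ ⟨U, hU, rfl⟩
    refine ⟨U, hU, ?_⟩
    rintro y rfl
    exact (hg (e y) ⟨y, rfl⟩).2 (cself _ y)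
  · simp only [Nat.cast_zero, zero_add, Set.encard_le_one_iff]
    rintro _ _ ⟨⟨U, -, rfl⟩, rfl⟩ ⟨⟨U', -, rfl⟩, rfl⟩
    rfl

/-- A subspace that is covered, for every `n`, by a disjoint family of open sets each lying in a
ball of radius `1 / (n + 1)` has covering dimension zero. -/
theorem coveringDimLE_zero_of_disjoint_covers {X : Type*} [MetricSpace X] {Y : Set X}
    (𝒯 : ℕ → Set (Set X)) (hd : ∀ n, (𝒯 n).PairwiseDisjoint id)
    (ho : ∀ n, ∀ T ∈ 𝒯 n, IsOpen T)
    (hsmall : ∀ n, ∀ T ∈ 𝒯 n, ∃ x, T ⊆ Metric.ball x (1 / ((n : ℝ) + 1)))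
    (hc : ∀ n, Y ⊆ ⋃₀ 𝒯 n) : CoveringDimLE Y 0 := by
  choose T hT hmem using fun n (y : Y) => hc n y.2
  refine coveringDimLE_zero_of_partitions (fun n y => ((↑) : Y → X) ⁻¹' T n y)
    (fun n y => (ho n _ (hT n y)).preimage continuous_subtype_val) hmem (fun n y z hz => ?_)
    fun y U hU hy => ?_
  · have : T n z = T n y := by
      by_contra hne
      exact Set.disjoint_left.1 (hd n (hT n z) (hT n y) hne) (hmem n z) hz
    simp only [this]
  · obtain ⟨ε, ε0, hε⟩ := Metric.isOpen_iff.1 hU y hy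
    obtain ⟨n, hn⟩ := exists_nat_one_div_lt (half_pos ε0)
    refine ⟨n, fun z hz => hε ?_⟩
    obtain ⟨x, hx⟩ := hsmall n _ (hT n y)
    have h1 : dist (z : X) x < _ := hx hz
    have h2 : dist (y : X) x < _ := hx (hmem n y)
    have h3 := dist_triangle_right (z : X) y x
    rw [Metric.mem_ball, Subtype.dist_eq]
    linarith

/-! ### Countable dimensionality from a winning strategy -/

/-- The cover of `X` by all balls of radius `1 / (n + 1)`. -/
def ballCover (X : Type*) [MetricSpace X] (n : ℕ) : Set (Set X) :=
  Set.range fun x : X => Metric.ball x (1 / ((n : ℝ) + 1))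

theorem ballCover_mem_openCovers (X : Type*) [MetricSpace X] (n : ℕ) :
    ballCover X n ∈ openCovers X := by
  refine ⟨?_, Set.eq_univ_of_forall fun x =>
    ⟨_, ⟨x, rfl⟩, Metric.mem_ball_self Nat.one_div_pos_of_nat⟩⟩
  rintro _ ⟨x, rfl⟩
  exact Metric.isOpen_ball

/-- The moves of ONE that play the ball covers with the indices listed in `τ`, continued
arbitrarily (by index `0`) after the end of `τ`. -/
def ballPlay (X : Type*) [MetricSpace X] (τ : List ℕ) (i : ℕ) : Set (Set X) :=
  ballCover X (τ.getD i 0)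

/-- The points covered by TWO's answer in the inning after ONE has played the indices `τ`,
whichever ball cover ONE plays in that inning. -/
def coreSet {X : Type*} [MetricSpace X] (σ : StrategyTwo X) (τ : List ℕ) : Set X :=
  ⋂ n, ⋃₀ σ.answer (ballPlay X (τ ++ [n])) τ.length

theorem StrategyTwo.answer_congr {S : Type*} (σ : StrategyTwo S) {O O' : ℕ → Set (Set S)} {n : ℕ}
    (h : ∀ i ≤ n, O i = O' i) : σ.answer O n = σ.answer O' n :=
  congrArg (σ n) (funext fun i => h i (Nat.lt_succ_iff.1 i.2))

theorem coveringDimLE_coreSet {X : Type*} [MetricSpace X] {σ : StrategyTwo X}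
    (hσ : σ.IsWinning (openCovers X) (openCovers X)) (τ : List ℕ) :
    CoveringDimLE (coreSet σ τ) 0 := by
  have hwin := fun n => hσ (ballPlay X (τ ++ [n])) fun i => ballCover_mem_openCovers X _
  refine coveringDimLE_zero_of_disjoint_covers
    (fun n => σ.answer (ballPlay X (τ ++ [n])) τ.length) (fun n => ((hwin n).1 _).1)
    -- the answers consist of open sets because they are part of an open cover
    (fun n T hT => (hwin n).2.1 T (Set.mem_iUnion.2 ⟨_, hT⟩)) (fun n T hT => ?_)
    fun n => Set.iInter_subset _ n
  obtain ⟨U, hU, hTU⟩ := ((hwin n).1 _).2 T hT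
  have hlast : ballPlay X (τ ++ [n]) τ.length = ballCover X n := by simp [ballPlay]
  rw [hlast] at hU
  obtain ⟨x, rfl⟩ := hU
  exact ⟨x, hTU⟩

/-- If a point were outside every core set, ONE could choose an index in each inning so that the
point stays uncovered, and TWO would lose. -/
theorem iUnion_coreSet {X : Type*} [MetricSpace X] {σ : StrategyTwo X}
    (hσ : σ.IsWinning (openCovers X) (openCovers X)) : ⋃ τ, coreSet σ τ = Set.univ := by
  refine Set.eq_univ_of_forall fun x => ?_
  by_contra hx
  simp only [coreSet, Set.mem_iUnion, Set.mem_iInter, not_exists, not_forall] at hx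
  choose n hn using hx
  let f : ℕ → List ℕ := fun k => Nat.rec [] (fun _ τ => τ ++ [n τ]) k
  have fsucc : ∀ k, f (k + 1) = f k ++ [n (f k)] := fun k => rfl
  have flen : ∀ k, (f k).length = k := by
    intro k
    induction k with
    | zero => rfl
    | succ k ih => rw [fsucc, List.length_append, ih, List.length_singleton]
  have fget : ∀ k, ∀ i < k, (f k).getD i 0 = n (f i) := by
    intro k
    induction k with
    | zero => exact fun i hi => absurd hi (Nat.not_lt_zero i)
    | succ k ih =>
      intro i hi
      rw [fsucc]
      rcases (Nat.lt_succ_iff.1 hi).lt_or_eq with h | rfl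
      · rw [List.getD_append _ _ _ _ (by rwa [flen]), ih i h]
      · rw [List.getD_append_right _ _ _ _ (by rw [flen]), flen]
        simp
  obtain ⟨T, hT, hxT⟩ : x ∈ ⋃₀ ⋃ k, σ.answer (fun i => ballCover X (n (f i))) k :=
    (hσ _ fun i => ballCover_mem_openCovers X _).2.2.symm ▸ Set.mem_univ x
  obtain ⟨k, hk⟩ := Set.mem_iUnion.1 hT
  refine hn (f k) ⟨T, ?_, hxT⟩
  rw [flen, ← fsucc]
  refine (σ.answer_congr fun i hi => ?_) ▸ hk
  rw [ballPlay, fget _ i (Nat.lt_succ_of_le hi)]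

theorem countableDimensional_of_twoHasWinningStrategy {X : Type*} [MetricSpace X]
    (h : TwoHasWinningStrategy (openCovers X) (openCovers X)) : CountableDimensional X := by
  obtain ⟨σ, hσ⟩ := h
  let e : ℕ ≃ List ℕ := (Denumerable.eqv (List ℕ)).symm
  refine ⟨fun i => coreSet σ (e i), fun i => coveringDimLE_coreSet hσ _, ?_⟩
  rw [e.surjective.iUnion_comp (coreSet σ), iUnion_coreSet hσ]

theorem mainTheorem1 (X : Type*) [MetricSpace X] :
    (CountableDimensional X → TwoHasWinningStrategy (openCovers X) (openCovers X)) ∧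
    (TwoHasWinningStrategy (openCovers X) (openCovers X) → CountableDimensional X) :=
  ⟨twoHasWinningStrategy_of_countableDimensional, countableDimensional_of_twoHasWinningStrategy⟩
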